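/- Let $G=(V,E)$ be a finite simple undirected graph with $n=|V|$ vertices. A $k$-strong component of $G$ is a maximal vertex-induced subgraph all of whose cuts (into two nonempty sides) contain at least $k$ edges, and the strong connectivity $s_e$ of an edge $e\in E$ is the largest $k$ such that $e$ lies in a $k$-strong component. Fix a real $d\ge 0$ and put $\lambda'=12(d+2)\log n$ (natural logarithm). The edge strong-connectivity tester, run on an edge $e=(u,v)\in E$ with a guess $g>0$, starts with $S=V$ and performs $\lceil\log_{3/2} n\rceil$ rounds. In each round it keeps each edge of the subgraph of $G$ induced by the current $S$ independently, with fresh randomness, with probability $p=\min(1,\lambda'/g)$; it then replaces $S$ by the set of vertices reachable from $u$ along kept edges; if $v\notin S$, it outputs reject and stops. If it completes all rounds, it outputs accept. There is an absolute constant $C>0$ such that for all such $G$, $d$, $e=(u,v)$ and all $g$ with $0<g\le s_e$, the probability that the tester fails to accept with $v\in S$ after every round is at most $C\,n^{-d}\log n$. That is, with error probability $O(n^{-d}\log n)$, $v$ stays in $S$ through every round and the tester accepts. -/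

import Mathlib

open MeasureTheory ProbabilityTheory

noncomputable section

namespace StrongConn

/-- The number of edges of `H` crossing the cut `(A, Aᶜ)`. -/
def cutValue {X : Type*} (H : SimpleGraph X) (A : Set X) : ℕ :=
  {e ∈ H.edgeSet | ∃ a ∈ A, ∃ b ∈ Aᶜ, e = s(a, b)}.ncard

/-- `H` has min-cut at least `k`: each cut with two nonempty sides has at least `k` edges. -/
def IsKConnected {X : Type*} (H : SimpleGraph X) (k : ℕ) : Prop :=
  ∀ A : Set X, A.Nonempty → Aᶜ.Nonempty → k ≤ cutValue H A

/-- `W` is the vertex set of a `k`-strong component of `G`: a maximal `k`-connected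
vertex-induced subgraph. -/
def IsStrongComponent {V : Type*} (G : SimpleGraph V) (k : ℕ) (W : Set V) : Prop :=
  Maximal (fun U : Set V => IsKConnected (G.induce U) k) W

/-- The strong connectivity `s_e` of an edge `e` of `G`: the largest `k` such that `e` lies in a
`k`-strong component of `G`. (For an edge of a finite graph this set of `k` is nonempty and
bounded, so the supremum is a maximum.) -/
def strongConnectivity {V : Type*} (G : SimpleGraph V) (e : Sym2 V) : ℕ :=
  sSup {k : ℕ | ∃ W : Set V, IsStrongComponent G k W ∧ ∀ x ∈ e, x ∈ W}

/-- `λ' = 12 (d + 2) log n`. -/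
def lambdaPrime (d : ℝ) (n : ℕ) : ℝ := 12 * (d + 2) * Real.log n

/-- The edges of the subgraph `G_t` of `G` induced by `S`, as edges on the vertex set `V`. -/
def inducedEdges {V : Type*} (G : SimpleGraph V) (S : Set V) : Set (Sym2 V) :=
  {e ∈ G.edgeSet | ∀ x ∈ e, x ∈ S}

/-- The law of the edge set of a random skeleton: each edge of the subgraph of `G` induced by `S`
is kept independently with probability `p`, where `p` is truncated to `[0, 1]`. -/
def skeleton {V : Type*} [Finite V] (G : SimpleGraph V) (S : Set V) (p : ℝ) : PMF (Set (Sym2 V)) :=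
  (setBernoulli (inducedEdges G S) (Set.projIcc 0 1 zero_le_one p)).toPMF

/-- The vertices reachable from `u` in the graph with edge set `F`. -/
def reachableSet {V : Type*} (F : Set (Sym2 V)) (u : V) : Set V :=
  {w | (SimpleGraph.fromEdgeSet F).Reachable u w}

open scoped Classical in
/-- `r` further rounds of the tester with sampling probability `p`, started from the current vertex
set `S`. The output is the verdict (`true` is accept, `false` is reject) together with the list of
the sets `S` that the executed rounds produced, in order. -/
def testerRounds {V : Type*} [Finite V] (G : SimpleGraph V) (u v : V) (p : ℝ) :
    ℕ → Set V → PMF (Bool × List (Set V))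
  | 0, _ => PMF.pure (true, [])
  | r + 1, S => (skeleton G S p).bind fun F =>
      let S' := reachableSet F u
      if v ∈ S' then
        (testerRounds G u v p r S').map fun o => (o.1, S' :: o.2)
      else
        PMF.pure (false, [S'])

/-- The edge strong connectivity tester on the graph `G`, the edge `(u, v)` and the guess `g`:
`⌈log_{3/2} n⌉` rounds with sampling probability `λ' / g`, started from `S = V`. -/
def tester {V : Type*} [Fintype V] (G : SimpleGraph V) (u v : V) (d g : ℝ) :
    PMF (Bool × List (Set V)) :=
  testerRounds G u v (lambdaPrime d (Fintype.card V) / g)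
    ⌈Real.logb (3 / 2) (Fintype.card V)⌉₊ Set.univ

end StrongConn

end

open MeasureTheory ProbabilityTheory

namespace StrongConn

/-! Let `W` contain both endpoints and induce a `k`-connected subgraph, `k` being the strong
connectivity of the edge. If `W ⊆ S` and the kept edges leave `W` inside one component, then `W`
lies in the next `S`. So a union bound over the O(log n) rounds (`testerRounds_failure_le`) reduces
the claim to a failure probability of at most n^(-d) per round.

No cuts are counted for that bound. Let φ(F) be the number of components of `F` meeting `W`, minus
one. Each of them, when there are several, is left by at least `k` edges inside `W`, so at least
⌊k/2⌋ φ(F) missing edges lower φ when added. Averaging over the layers of the powerset gives E φ ≤ n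
(1 - p)^⌊k/2⌋ (`sum_powerset_weight_le`), and Markov's inequality bounds the probability that `W` is
split (`skeleton_disconnect_le`). Since p g = λ' and g ≤ k, this is at most n^(-d) when p < 1; when
p ≥ 1 every edge is kept. -/

/-! ### Decreasing potentials under independent sampling. -/

/-- Double counting of the pairs `F ⊂ insert e F` between consecutive layers of the powerset. -/
theorem sum_powersetCard_succ {α : Type*} [DecidableEq α] (E : Finset α) (φ : Finset α → ℝ)
    (j : ℕ) :
    ((j : ℝ) + 1) * ∑ F ∈ E.powersetCard (j + 1), φ F =
      ∑ F ∈ E.powersetCard j, ∑ e ∈ E \ F, φ (insert e F) := by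
  have h : ((j : ℝ) + 1) * ∑ F ∈ E.powersetCard (j + 1), φ F =
      ∑ F ∈ E.powersetCard (j + 1), ∑ _e ∈ F, φ F := by
    rw [Finset.mul_sum]
    refine Finset.sum_congr rfl fun F hF => ?_
    rw [Finset.sum_const, (Finset.mem_powersetCard.1 hF).2, nsmul_eq_mul]
    push_cast
    ring
  rw [h, Finset.sum_sigma', Finset.sum_sigma']
  refine Finset.sum_bij' (fun x _ => ⟨x.1.erase x.2, x.2⟩) (fun x _ => ⟨insert x.2 x.1, x.2⟩)
    ?_ ?_ ?_ ?_ ?_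
  · rintro ⟨F, e⟩ hx
    simp only [Finset.mem_sigma, Finset.mem_powersetCard, Finset.mem_sdiff] at hx ⊢
    refine ⟨⟨(Finset.erase_subset _ _).trans hx.1.1, ?_⟩, hx.1.1 hx.2, by simp⟩
    rw [Finset.card_erase_of_mem hx.2, hx.1.2]
    rfl
  · rintro ⟨F, e⟩ hx
    simp only [Finset.mem_sigma, Finset.mem_powersetCard, Finset.mem_sdiff] at hx ⊢
    refine ⟨⟨Finset.insert_subset hx.2.1 hx.1.1, ?_⟩, by simp⟩
    rw [Finset.card_insert_of_notMem hx.2.2, hx.1.2]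
  · rintro ⟨F, e⟩ hx
    simp only [Finset.mem_sigma] at hx
    simp [Finset.insert_erase hx.2]
  · rintro ⟨F, e⟩ hx
    simp only [Finset.mem_sigma, Finset.mem_sdiff] at hx
    simp [Finset.erase_insert hx.2.2]
  · rintro ⟨F, e⟩ hx
    simp only [Finset.mem_sigma] at hx
    simp [Finset.insert_erase hx.2]

/-- If adding a uniformly random missing element decreases a nonnegative potential by a definite
proportion, then each layer sum of the potential is bounded by a binomial coefficient. -/
theorem sum_powersetCard_le {α : Type*} [DecidableEq α] (E : Finset α) (φ : Finset α → ℝ)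
    (h : ℕ) (h0 : ∀ F ⊆ E, 0 ≤ φ F)
    (hφ : ∀ F ⊆ E, ∑ e ∈ E \ F, φ (insert e F) ≤ ((E.card : ℝ) - F.card - h) * φ F)
    (hh : h ≤ E.card) (j : ℕ) :
    ∑ F ∈ E.powersetCard j, φ F ≤ φ ∅ * (E.card - h).choose j := by
  induction j with
  | zero => simp
  | succ j ih =>
    have hstep : ((j : ℝ) + 1) * ∑ F ∈ E.powersetCard (j + 1), φ F ≤
        ((E.card : ℝ) - j - h) * ∑ F ∈ E.powersetCard j, φ F := by
      rw [sum_powersetCard_succ, Finset.mul_sum]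
      refine Finset.sum_le_sum fun F hF => ?_
      obtain ⟨hF, hj⟩ := Finset.mem_powersetCard.1 hF
      simpa [hj] using hφ F hF
    have hnn : 0 ≤ ∑ F ∈ E.powersetCard j, φ F :=
      Finset.sum_nonneg fun F hF => h0 F (Finset.mem_powersetCard.1 hF).1
    have hj : (0 : ℝ) < (j : ℝ) + 1 := by positivity
    refine le_of_mul_le_mul_left (hstep.trans ?_) hj
    -- Once `j` reaches `E.card - h` the binomial coefficient vanishes and the factor in `hstep` is
    -- nonpositive, so both sides agree in sign.
    rcases le_or_gt (E.card - h) j with hle | hlt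
    · rw [Nat.choose_eq_zero_of_lt (Nat.lt_succ_of_le hle)]
      have : ((E.card : ℝ) - j - h) ≤ 0 := by
        have : (E.card : ℝ) ≤ j + h := by exact_mod_cast (by omega : E.card ≤ j + h)
        linarith
      simpa using mul_nonpos_of_nonpos_of_nonneg this hnn
    · have hc : ((E.card : ℝ) - j - h) = ((E.card - h - j : ℕ) : ℝ) := by
        rw [Nat.cast_sub hlt.le, Nat.cast_sub hh]
        ring
      have hch : (((E.card - h).choose (j + 1) : ℕ) : ℝ) * (j + 1) =
          ((E.card - h).choose j : ℕ) * ((E.card - h - j : ℕ) : ℝ) := by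
        exact_mod_cast Nat.choose_succ_right_eq (E.card - h) j
      rw [hc]
      calc ((E.card - h - j : ℕ) : ℝ) * ∑ F ∈ E.powersetCard j, φ F
          ≤ ((E.card - h - j : ℕ) : ℝ) * (φ ∅ * (E.card - h).choose j) := by gcongr
        _ = _ := by linear_combination -(φ ∅) * hch

/-- The expectation of such a potential under independent sampling with probability `p`. -/
theorem sum_powerset_weight_le {α : Type*} [DecidableEq α] (E : Finset α) (φ : Finset α → ℝ)
    (h : ℕ) (h0 : ∀ F ⊆ E, 0 ≤ φ F)
    (hφ : ∀ F ⊆ E, ∑ e ∈ E \ F, φ (insert e F) ≤ ((E.card : ℝ) - F.card - h) * φ F)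
    (hh : h ≤ E.card) {p : ℝ} (hp0 : 0 ≤ p) (hp1 : p ≤ 1) :
    ∑ F ∈ E.powerset, p ^ F.card * (1 - p) ^ (E.card - F.card) * φ F ≤ φ ∅ * (1 - p) ^ h := by
  have hq : 0 ≤ 1 - p := by linarith
  have hM : E.card - h + h = E.card := Nat.sub_add_cancel hh
  rw [Finset.sum_powerset]
  calc ∑ j ∈ Finset.range (E.card + 1), ∑ F ∈ E.powersetCard j,
          p ^ F.card * (1 - p) ^ (E.card - F.card) * φ F
      = ∑ j ∈ Finset.range (E.card + 1),
          p ^ j * (1 - p) ^ (E.card - j) * ∑ F ∈ E.powersetCard j, φ F := by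
        refine Finset.sum_congr rfl fun j _ => ?_
        rw [Finset.mul_sum]
        refine Finset.sum_congr rfl fun F hF => ?_
        rw [(Finset.mem_powersetCard.1 hF).2]
    _ ≤ ∑ j ∈ Finset.range (E.card + 1),
          p ^ j * (1 - p) ^ (E.card - j) * (φ ∅ * (E.card - h).choose j) := by
        refine Finset.sum_le_sum fun j _ => ?_
        exact mul_le_mul_of_nonneg_left (sum_powersetCard_le E φ h h0 hφ hh j) (by positivity)
    _ = ∑ j ∈ Finset.range (E.card - h + 1),
          p ^ j * (1 - p) ^ (E.card - j) * (φ ∅ * (E.card - h).choose j) := by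
        symm
        refine Finset.sum_subset (fun j hj => ?_) fun j _ hj => ?_
        · simp only [Finset.mem_range] at hj ⊢
          omega
        · rw [Nat.choose_eq_zero_of_lt (by simpa using hj)]
          simp
    -- The factor `(1 - p) ^ h` comes out of every term; what remains is the binomial expansion of
    -- 1.
    _ = φ ∅ * (1 - p) ^ h * (p + (1 - p)) ^ (E.card - h) := by
        rw [add_pow, Finset.mul_sum]
        refine Finset.sum_congr rfl fun j hj => ?_
        have : E.card - j = h + (E.card - h - j) := by
          have := Finset.mem_range.1 hj
          omega
        rw [this, pow_add]
        ring
    _ = φ ∅ * (1 - p) ^ h := by simp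

/-! ### Components meeting `W` and the edges between them. -/

/-- The connected components of the graph with edge set `F` that meet `W`. -/
def componentsMeeting {V : Type*} (F : Set (Sym2 V)) (W : Set V) :
    Set (SimpleGraph.fromEdgeSet F).ConnectedComponent :=
  (SimpleGraph.fromEdgeSet F).connectedComponentMk '' W

/-- The edges of `G` inside `W` that join different components of the graph with edge set `F`. -/
def crossingEdges {V : Type*} (G : SimpleGraph V) (W : Set V) (F : Set (Sym2 V)) :
    Set (Sym2 V) :=
  {e ∈ inducedEdges G W | ∃ a b, e = s(a, b) ∧ ¬ (SimpleGraph.fromEdgeSet F).Reachable a b}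

theorem crossingEdges_disjoint {V : Type*} {G : SimpleGraph V} {W : Set V} {F : Set (Sym2 V)}
    {e : Sym2 V} (he : e ∈ crossingEdges G W F) : e ∉ F := by
  obtain ⟨⟨hG, _⟩, a, b, rfl, hab⟩ := he
  intro hF
  exact hab (SimpleGraph.Adj.reachable ((SimpleGraph.fromEdgeSet_adj _).2 ⟨hF, G.ne_of_adj hG⟩))

theorem inducedEdges_mono {V : Type*} (G : SimpleGraph V) {S T : Set V} (h : S ⊆ T) :
    inducedEdges G S ⊆ inducedEdges G T :=
  fun _ he => ⟨he.1, fun x hx => h (he.2 x hx)⟩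

theorem image_componentsMeeting {V : Type*} {F F' : Set (Sym2 V)} (h : F ⊆ F') (W : Set V) :
    SimpleGraph.ConnectedComponent.map
        (SimpleGraph.Hom.ofLE (SimpleGraph.fromEdgeSet_mono h)) '' componentsMeeting F W =
      componentsMeeting F' W := by
  simp only [componentsMeeting, Set.image_image]
  rfl

theorem ncard_componentsMeeting_anti {V : Type*} [Finite V] {F F' : Set (Sym2 V)} (h : F ⊆ F')
    (W : Set V) : (componentsMeeting F' W).ncard ≤ (componentsMeeting F W).ncard := by
  rw [← image_componentsMeeting h]
  exact Set.ncard_image_le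

/-- With equal counts, the surjection from old components to new ones would be injective on those
meeting `W`, yet it merges the components of the endpoints of `e`, which lie in `W`. -/
theorem ncard_componentsMeeting_insert_lt {V : Type*} [Finite V] {G : SimpleGraph V} {W : Set V}
    {F : Set (Sym2 V)} {e : Sym2 V} (he : e ∈ crossingEdges G W F) :
    (componentsMeeting (insert e F) W).ncard < (componentsMeeting F W).ncard := by
  obtain ⟨⟨hG, hW⟩, a, b, rfl, hab⟩ := he
  refine lt_of_le_of_ne (ncard_componentsMeeting_anti (Set.subset_insert _ _) W) fun heq => ?_
  rw [← image_componentsMeeting (Set.subset_insert s(a, b) F), Set.ncard_image_iff] at heq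
  refine hab (SimpleGraph.ConnectedComponent.exact
    (heq ⟨a, hW a (by simp), rfl⟩ ⟨b, hW b (by simp), rfl⟩ ?_))
  refine SimpleGraph.ConnectedComponent.sound (SimpleGraph.Adj.reachable ?_)
  exact (SimpleGraph.fromEdgeSet_adj _).2 ⟨Set.mem_insert _ _, G.ne_of_adj hG⟩

theorem le_ncard_boundary {V : Type*} [Finite V] {G : SimpleGraph V} {W : Set V} {k : ℕ}
    (hk : IsKConnected (G.induce W) k) {A : Set V} (hA : (W ∩ A).Nonempty)
    (hA' : (W \ A).Nonempty) :
    k ≤ {e ∈ inducedEdges G W | ∃ a ∈ A, ∃ b ∉ A, e = s(a, b)}.ncard := by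
  obtain ⟨x, hxW, hxA⟩ := hA
  obtain ⟨y, hyW, hyA⟩ := hA'
  refine (hk (Subtype.val ⁻¹' A) ⟨⟨x, hxW⟩, hxA⟩ ⟨⟨y, hyW⟩, hyA⟩).trans ?_
  refine Set.ncard_le_ncard_of_injOn (Sym2.map Subtype.val) ?_
    (Sym2.map.injective Subtype.val_injective).injOn
  rintro _ ⟨hG, a, ha, b, hb, rfl⟩
  refine ⟨⟨hG, ?_⟩, a, ha, b, hb, rfl⟩
  intro z hz
  rcases Sym2.mem_iff.1 hz with rfl | rfl
  · exact a.2
  · exact b.2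

/-- Double counting of component-edge incidences: each component cuts `W` nontrivially because
another one meets `W`, and an edge touches at most two components. -/
theorem ncard_mul_le_two_mul_crossingEdges {V : Type*} [Finite V] {G : SimpleGraph V} {W : Set V}
    {k : ℕ} (hk : IsKConnected (G.induce W) k) (F : Set (Sym2 V))
    (h2 : 1 < (componentsMeeting F W).ncard) :
    (componentsMeeting F W).ncard * k ≤ 2 * (crossingEdges G W F).ncard := by
  classical
  have := Fintype.ofFinite V
  have := Fintype.ofFinite (SimpleGraph.fromEdgeSet F).ConnectedComponent
  set H := SimpleGraph.fromEdgeSet F with hH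
  let r : H.ConnectedComponent → Sym2 V → Prop := fun c e => ∃ a b, e = s(a, b) ∧
    H.connectedComponentMk a = c ∧ H.connectedComponentMk b ≠ c
  rw [Set.ncard_eq_toFinset_card' (componentsMeeting F W),
    Set.ncard_eq_toFinset_card' (crossingEdges G W F), mul_comm 2]
  refine Finset.card_mul_le_card_mul r (fun c hc => ?_) fun e he => ?_
  · rw [Set.mem_toFinset] at hc
    obtain ⟨c', hc', hne⟩ := Set.exists_ne_of_one_lt_ncard h2 c
    obtain ⟨x, hxW, rfl⟩ := hc
    obtain ⟨y, hyW, rfl⟩ := hc'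
    refine (le_ncard_boundary hk
      (A := {z | H.connectedComponentMk z = H.connectedComponentMk x})
      ⟨x, hxW, rfl⟩ ⟨y, hyW, hne⟩).trans ?_
    rw [← Set.ncard_coe_finset]
    refine Set.ncard_le_ncard ?_ (Set.toFinite _)
    rintro e ⟨he, a, ha, b, hb, rfl⟩
    rw [Finset.mem_coe, Finset.mem_bipartiteAbove, Set.mem_toFinset]
    refine ⟨⟨he, a, b, rfl, fun hr => hb ?_⟩, a, b, rfl, ha, hb⟩
    exact (SimpleGraph.ConnectedComponent.sound hr).symm.trans ha
  · induction e with | _ a b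
    have hs : Finset.bipartiteBelow r (componentsMeeting F W).toFinset s(a, b) ⊆
        {H.connectedComponentMk a, H.connectedComponentMk b} := by
      intro c hc
      obtain ⟨-, a', b', hab, rfl, -⟩ := (Finset.mem_bipartiteBelow r).1 hc
      rcases Sym2.eq_iff.1 hab with ⟨rfl, rfl⟩ | ⟨rfl, rfl⟩ <;> simp
    exact (Finset.card_le_card hs).trans Finset.card_le_two

/-! ### The potential: component excess. -/

/-- The number of components meeting `W`, minus one. -/
noncomputable def componentExcess {V : Type*} (W : Set V) (F : Set (Sym2 V)) : ℝ :=
  (componentsMeeting F W).ncard - 1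

theorem one_le_ncard_componentsMeeting {V : Type*} [Finite V] {W : Set V} (hW : W.Nonempty)
    (F : Set (Sym2 V)) : 1 ≤ (componentsMeeting F W).ncard :=
  (Set.ncard_pos).2 (hW.image _)

theorem componentExcess_nonneg {V : Type*} [Finite V] {W : Set V} (hW : W.Nonempty)
    (F : Set (Sym2 V)) : 0 ≤ componentExcess W F := by
  rw [componentExcess, sub_nonneg]
  exact_mod_cast one_le_ncard_componentsMeeting hW F

theorem componentExcess_le {V : Type*} [Fintype V] (W : Set V) (F : Set (Sym2 V)) :
    componentExcess W F ≤ Fintype.card V := by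
  have h : (componentsMeeting F W).ncard ≤ Fintype.card V := by
    refine (Set.ncard_image_le (Set.toFinite W)).trans ?_
    rw [← Nat.card_eq_fintype_card, ← Set.ncard_univ]
    exact Set.ncard_le_ncard (Set.subset_univ W)
  have : ((componentsMeeting F W).ncard : ℝ) ≤ Fintype.card V := by exact_mod_cast h
  rw [componentExcess]
  linarith

theorem one_le_componentExcess {V : Type*} [Finite V] {W : Set V} {u : V} (hu : u ∈ W)
    {F : Set (Sym2 V)} (h : ¬ W ⊆ reachableSet F u) : 1 ≤ componentExcess W F := by
  obtain ⟨w, hw, hr⟩ := Set.not_subset.1 h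
  have : 1 < (componentsMeeting F W).ncard := by
    refine (Set.one_lt_ncard).2 ⟨_, ⟨u, hu, rfl⟩, _, ⟨w, hw, rfl⟩, fun heq => hr ?_⟩
    exact SimpleGraph.ConnectedComponent.exact heq
  have : (2 : ℝ) ≤ (componentsMeeting F W).ncard := by exact_mod_cast this
  rw [componentExcess]
  linarith

/-- The natural-number quotient is used because ⌊k/2⌋ serves as `h`, an exponent and a binomial
parameter. A single component has excess zero. -/
theorem mul_componentExcess_le {V : Type*} [Finite V] {G : SimpleGraph V} {W : Set V}
    (hW : W.Nonempty) {k : ℕ} (hk : IsKConnected (G.induce W) k) (F : Set (Sym2 V)) :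
    ((k / 2 : ℕ) : ℝ) * componentExcess W F ≤ (crossingEdges G W F).ncard := by
  have h1 := one_le_ncard_componentsMeeting hW F
  rcases h1.lt_or_eq with h2 | h2
  · have h3 := ncard_mul_le_two_mul_crossingEdges hk F h2
    obtain ⟨m, hm⟩ := Nat.exists_eq_add_of_le h1
    have h4 : k / 2 * m ≤ (crossingEdges G W F).ncard := by
      have : 2 * (k / 2) ≤ k := Nat.mul_div_le k 2
      rw [hm] at h3
      nlinarith
    have h5 : componentExcess W F = m := by rw [componentExcess, hm]; push_cast; ring
    rw [h5]
    exact_mod_cast h4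
  · rw [componentExcess, ← h2]
    simp

theorem reachable_of_inducedEdges {V : Type*} [Finite V] {G : SimpleGraph V} {W : Set V} {k : ℕ}
    (hk1 : 1 ≤ k) (hk : IsKConnected (G.induce W) k) {u : V} (hu : u ∈ W) {F : Set (Sym2 V)}
    (hF : inducedEdges G W ⊆ F) : W ⊆ reachableSet F u := by
  by_contra h
  have h2 : 1 < (componentsMeeting F W).ncard := by
    have h := one_le_componentExcess hu h
    rw [componentExcess] at h
    have : (2 : ℝ) ≤ (componentsMeeting F W).ncard := by linarith
    exact_mod_cast this
  have h3 := ncard_mul_le_two_mul_crossingEdges hk F h2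
  have h4 : crossingEdges G W F = ∅ :=
    Set.eq_empty_of_forall_notMem fun e he => crossingEdges_disjoint he (hF he.1)
  rw [h4, Set.ncard_empty] at h3
  nlinarith

/-- This is the decrease hypothesis of `sum_powerset_weight_le`: crossing edges lower the excess by
at least one and all lie in `E \ F`, while other edges never raise it. -/
theorem sum_componentExcess_insert_le {V : Type*} [Finite V] [DecidableEq (Sym2 V)]
    {G : SimpleGraph V} {W : Set V}
    (hW : W.Nonempty) {k : ℕ} (hk : IsKConnected (G.induce W) k) {E F : Finset (Sym2 V)}
    (hE : inducedEdges G W ⊆ E) (hF : F ⊆ E) :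
    ∑ e ∈ E \ F, componentExcess W ((insert e F : Finset (Sym2 V)) : Set (Sym2 V)) ≤
      ((E.card : ℝ) - F.card - (k / 2 : ℕ)) * componentExcess W F := by
  classical
  have hterm : ∀ e ∈ E \ F, componentExcess W ((insert e F : Finset (Sym2 V)) : Set (Sym2 V)) ≤
      componentExcess W F - if e ∈ crossingEdges G W F then 1 else 0 := by
    intro e _
    rw [Finset.coe_insert]
    split_ifs with he
    · have := ncard_componentsMeeting_insert_lt he
      have : ((componentsMeeting (insert e (F : Set (Sym2 V))) W).ncard : ℝ) + 1 ≤
        (componentsMeeting (F : Set (Sym2 V)) W).ncard := by exact_mod_cast this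
      rw [componentExcess, componentExcess]
      linarith
    · have : ((componentsMeeting (insert e (F : Set (Sym2 V))) W).ncard : ℝ) ≤
          (componentsMeeting (F : Set (Sym2 V)) W).ncard := by
        exact_mod_cast ncard_componentsMeeting_anti (Set.subset_insert _ _) W
      rw [componentExcess, componentExcess]
      linarith
  refine (Finset.sum_le_sum hterm).trans ?_
  have hcross : ∑ e ∈ E \ F, (if e ∈ crossingEdges G W F then (1 : ℝ) else 0) =
      (crossingEdges G W F).ncard := by
    rw [Finset.sum_boole, ← Set.ncard_coe_finset]
    congr 2
    ext e
    simp only [Finset.coe_filter, Finset.mem_sdiff, Set.mem_ofPred_eq]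
    exact ⟨fun h => h.2, fun h => ⟨⟨hE h.1, crossingEdges_disjoint h⟩, h⟩⟩
  rw [Finset.sum_sub_distrib, hcross, Finset.sum_const, Finset.card_sdiff_of_subset hF,
    nsmul_eq_mul, Nat.cast_sub (Finset.card_le_card hF)]
  have := mul_componentExcess_le hW hk (F : Set (Sym2 V))
  linarith

theorem half_le_card_of_isKConnected {V : Type*} [Finite V] {G : SimpleGraph V} {W : Set V}
    {k : ℕ} (hk : IsKConnected (G.induce W) k) {u v : V} (hu : u ∈ W) (hv : v ∈ W) (huv : u ≠ v)
    {E : Finset (Sym2 V)} (hE : inducedEdges G W ⊆ E) : k / 2 ≤ E.card := by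
  have h := le_ncard_boundary hk (A := {u}) ⟨u, hu, rfl⟩ ⟨v, hv, huv.symm⟩
  have h' : {e ∈ inducedEdges G W | ∃ a ∈ ({u} : Set V), ∃ b ∉ ({u} : Set V), e = s(a, b)}.ncard ≤
      E.card := by
    rw [← Set.ncard_coe_finset]
    exact Set.ncard_le_ncard fun e he => hE he.1
  omega

/-! ### Failure probability of one round. -/

theorem skeleton_toOuterMeasure {V : Type*} [Finite V] (G : SimpleGraph V) (S : Set V) (p : ℝ)
    (B : Set (Set (Sym2 V))) : (skeleton G S p).toOuterMeasure B =
      setBernoulli (inducedEdges G S) (Set.projIcc 0 1 zero_le_one p) B := by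
  rw [← PMF.toMeasure_apply_eq_toOuterMeasure_apply _ (Set.toFinite B).measurableSet, skeleton,
    Measure.toPMF_toMeasure]

/-- The probability that the random skeleton disconnects a vertex set inducing a `k`-connected
subgraph. -/
theorem skeleton_disconnect_le {V : Type*} [Fintype V] {G : SimpleGraph V} {W S : Set V}
    (hWS : W ⊆ S) {k : ℕ} (hk : IsKConnected (G.induce W) k) {u v : V} (hu : u ∈ W) (hv : v ∈ W)
    (huv : u ≠ v) {p : ℝ} (hp0 : 0 ≤ p) (hp1 : p ≤ 1) :
    (skeleton G S p).toOuterMeasure {F | ¬ W ⊆ reachableSet F u} ≤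
      ENNReal.ofReal (Fintype.card V * (1 - p) ^ (k / 2)) := by
  classical
  set μ := setBernoulli (inducedEdges G S) (Set.projIcc 0 1 zero_le_one p) with hμ
  obtain ⟨E, hE⟩ : ∃ E : Finset (Sym2 V), (E : Set (Sym2 V)) = inducedEdges G S :=
    ⟨(Set.toFinite (inducedEdges G S)).toFinset, by simp⟩
  have hWE : inducedEdges G W ⊆ E := hE ▸ inducedEdges_mono G hWS
  have hq : 0 ≤ 1 - p := by linarith
  have hsing : ∀ F ∈ E.powerset, μ {(F : Set (Sym2 V))} =
      ENNReal.ofReal (p ^ F.card * (1 - p) ^ (E.card - F.card)) := by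
    intro F hF
    have hF' := Finset.mem_powerset.1 hF
    rw [← ENNReal.ofReal_toReal (measure_ne_top μ _), ← measureReal_def, hμ, ← hE,
      setBernoulli_real_singleton _ (Finset.coe_subset.2 hF') E.finite_toSet,
      Set.ncard_coe_finset, ← Finset.coe_sdiff, Set.ncard_coe_finset,
      Finset.card_sdiff_of_subset hF', Set.projIcc_of_mem zero_le_one ⟨hp0, hp1⟩]
  calc (skeleton G S p).toOuterMeasure {F | ¬ W ⊆ reachableSet F u}
      = μ {F ∈ {F | ¬ W ⊆ reachableSet F u} | F ⊆ inducedEdges G S} := by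
        rw [skeleton_toOuterMeasure, setBernoulli_apply_eq_apply_subsets]
    _ ≤ μ (⋃ F ∈ E.powerset.filter fun F : Finset (Sym2 V) =>
            ¬ W ⊆ reachableSet (F : Set (Sym2 V)) u,
          {(F : Set (Sym2 V))}) := by
        refine measure_mono fun F hF => ?_
        obtain ⟨hb, hFE⟩ := hF
        have hF' : ((Set.toFinite F).toFinset : Set (Sym2 V)) = F := by simp
        refine Set.mem_biUnion (x := (Set.toFinite F).toFinset) ?_ (by simp)
        rw [Finset.mem_coe, Finset.mem_filter, Finset.mem_powerset]
        rw [← Finset.coe_subset, hF', hE]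
        exact ⟨hFE, hb⟩
    _ ≤ ∑ F ∈ E.powerset.filter fun F : Finset (Sym2 V) =>
            ¬ W ⊆ reachableSet (F : Set (Sym2 V)) u,
          μ {(F : Set (Sym2 V))} := measure_biUnion_finset_le _ _
    -- Markov's inequality: the excess is at least one on every bad `F`.
    _ ≤ ∑ F ∈ E.powerset.filter fun F : Finset (Sym2 V) =>
            ¬ W ⊆ reachableSet (F : Set (Sym2 V)) u,
          ENNReal.ofReal (p ^ F.card * (1 - p) ^ (E.card - F.card) * componentExcess W F) := by
        refine Finset.sum_le_sum fun F hF => ?_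
        rw [Finset.mem_filter] at hF
        rw [hsing F hF.1]
        refine ENNReal.ofReal_le_ofReal (le_mul_of_one_le_right (by positivity) ?_)
        exact one_le_componentExcess hu hF.2
    _ ≤ ∑ F ∈ E.powerset,
          ENNReal.ofReal (p ^ F.card * (1 - p) ^ (E.card - F.card) * componentExcess W F) :=
        Finset.sum_le_sum_of_subset (Finset.filter_subset _ _)
    _ = ENNReal.ofReal (∑ F ∈ E.powerset,
          p ^ F.card * (1 - p) ^ (E.card - F.card) * componentExcess W F) := by
        refine (ENNReal.ofReal_sum_of_nonneg fun F _ => ?_).symm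
        exact mul_nonneg (by positivity) (componentExcess_nonneg ⟨u, hu⟩ _)
    _ ≤ ENNReal.ofReal (Fintype.card V * (1 - p) ^ (k / 2)) := by
        refine ENNReal.ofReal_le_ofReal ?_
        refine (sum_powerset_weight_le E (fun F => componentExcess W F) (k / 2)
          (fun F _ => componentExcess_nonneg ⟨u, hu⟩ _)
          (fun F hF => sum_componentExcess_insert_le ⟨u, hu⟩ hk hWE hF)
          (half_le_card_of_isKConnected hk hu hv huv hWE) hp0 hp1).trans ?_
        exact mul_le_mul_of_nonneg_right (componentExcess_le W _) (by positivity)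

theorem skeleton_disconnect_eq_zero {V : Type*} [Finite V] {G : SimpleGraph V} {W S : Set V}
    (hWS : W ⊆ S) {k : ℕ} (hk1 : 1 ≤ k) (hk : IsKConnected (G.induce W) k) {u : V} (hu : u ∈ W)
    {p : ℝ} (hp : 1 ≤ p) :
    (skeleton G S p).toOuterMeasure {F | ¬ W ⊆ reachableSet F u} = 0 := by
  have h1 : Set.projIcc (0 : ℝ) 1 zero_le_one p = 1 := Set.projIcc_of_right_le _ hp
  rw [skeleton_toOuterMeasure, h1, setBernoulli_one,
    Measure.dirac_apply' _ (Set.toFinite _).measurableSet]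
  exact Set.indicator_of_notMem
    (not_not.2 (reachable_of_inducedEdges hk1 hk hu (inducedEdges_mono G hWS))) _

/-! ### Union bound, strong connectivity and numerical estimates. -/

/-- Union bound over the rounds of the tester. -/
theorem testerRounds_failure_le {V : Type*} [Finite V] (G : SimpleGraph V) {u v : V} {p : ℝ}
    {W : Set V} (hv : v ∈ W) {δ : ENNReal}
    (hδ : ∀ S, W ⊆ S → (skeleton G S p).toOuterMeasure {F | ¬ W ⊆ reachableSet F u} ≤ δ)
    (r : ℕ) : ∀ S, W ⊆ S → (testerRounds G u v p r S).toOuterMeasure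
      {o | ¬ (o.1 = true ∧ ∀ S ∈ o.2, v ∈ S)} ≤ r * δ := by
  classical
  induction r with
  | zero =>
    intro S _
    simp [testerRounds]
  | succ r ih =>
    intro S hS
    rw [testerRounds, PMF.toOuterMeasure_bind_apply]
    set B : Set (Set (Sym2 V)) := {F | ¬ W ⊆ reachableSet F u} with hB
    -- On a bad skeleton the conditional failure probability is bounded by 1; on a good one `W`
    -- survives and the induction hypothesis applies.
    calc _ ≤ ∑' F, (B.indicator (skeleton G S p) F + skeleton G S p F * (r * δ)) := by
          refine ENNReal.tsum_le_tsum fun F => ?_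
          by_cases hF : F ∈ B
          · rw [Set.indicator_of_mem hF]
            refine le_add_right (mul_le_of_le_one_right' ?_)
            rw [PMF.toOuterMeasure_apply, ← PMF.tsum_coe]
            exact ENNReal.tsum_le_tsum fun _ => Set.indicator_le_self _ _ _
          · rw [Set.indicator_of_notMem hF, zero_add]
            have hW : W ⊆ reachableSet F u := not_not.1 hF
            refine mul_le_mul_right ?_ _
            simp only [hW hv, if_true, PMF.toOuterMeasure_map_apply]
            refine le_trans (measure_mono fun o ho => ?_) (ih _ hW)
            simpa [hW hv] using ho
      _ = (skeleton G S p).toOuterMeasure B + r * δ := by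
          rw [ENNReal.tsum_add, ENNReal.tsum_mul_right, PMF.tsum_coe, one_mul,
            PMF.toOuterMeasure_apply]
      _ ≤ δ + r * δ := by gcongr; exact hδ S hS
      _ = ((r + 1 : ℕ) : ENNReal) * δ := by push_cast; ring

/-- Positivity excludes the default `sSup ∅ = 0`. The cut around `u` bounds the admissible `k`, so
the supremum is attained. -/
theorem exists_isKConnected_strongConnectivity {V : Type*} [Finite V] (G : SimpleGraph V)
    {u v : V} (huv : u ≠ v) (h : 0 < strongConnectivity G s(u, v)) :
    ∃ W : Set V, u ∈ W ∧ v ∈ W ∧ IsKConnected (G.induce W) (strongConnectivity G s(u, v)) := by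
  have hne : {k : ℕ | ∃ W : Set V, IsStrongComponent G k W ∧ ∀ x ∈ s(u, v), x ∈ W}.Nonempty := by
    by_contra hne
    rw [strongConnectivity, Set.not_nonempty_iff_eq_empty.1 hne] at h
    simp at h
  have hbdd : BddAbove {k : ℕ | ∃ W : Set V, IsStrongComponent G k W ∧ ∀ x ∈ s(u, v), x ∈ W} := by
    refine ⟨(Set.univ : Set (Sym2 V)).ncard, ?_⟩
    rintro k ⟨W, hW, hm⟩
    exact (le_ncard_boundary hW.prop (A := {u}) ⟨u, hm u (by simp), rfl⟩
      ⟨v, hm v (by simp), huv.symm⟩).trans (Set.ncard_le_ncard (Set.subset_univ _))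
  obtain ⟨W, hW, hm⟩ := Nat.sSup_mem hne hbdd
  exact ⟨W, hm u (by simp), hm v (by simp), hW.prop⟩

theorem one_sub_pow_half_le {n k : ℕ} {d g : ℝ} (hn : 2 ≤ n) (hd : 0 ≤ d) (hg : 0 < g)
    (hgk : g ≤ k) (hp : lambdaPrime d n / g < 1) :
    (n : ℝ) * (1 - lambdaPrime d n / g) ^ (k / 2) ≤ (n : ℝ) ^ (-d) := by
  have hn2 : (2 : ℝ) ≤ n := by exact_mod_cast hn
  have hn0 : (0 : ℝ) < n := by linarith
  have hlog2 : 0.6931471803 < Real.log 2 := Real.log_two_gt_d9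
  have hlog : Real.log 2 ≤ Real.log n := Real.log_le_log (by norm_num) hn2
  have hlam : lambdaPrime d n < g := by rwa [div_lt_one hg] at hp
  have hlam12 : 12 ≤ lambdaPrime d n := by
    rw [lambdaPrime]
    nlinarith [mul_nonneg hd (by linarith : 0 ≤ Real.log n)]
  -- Here `p < 1` forces 12 ≤ λ' < g ≤ k, so rounding k/2 down costs little. Then p ⌊k/2⌋ ≥ p g / 3
  -- = 4 (d + 2) log n.
  have hk : (k : ℝ) / 3 ≤ ((k / 2 : ℕ) : ℝ) := by
    have hk12 : 12 ≤ k := by exact_mod_cast (by linarith : (12 : ℝ) ≤ k)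
    have : (k : ℝ) ≤ 3 * ((k / 2 : ℕ) : ℝ) := by exact_mod_cast (by omega : k ≤ 3 * (k / 2))
    linarith
  set p := lambdaPrime d n / g with hpdef
  have hpg : p * g = lambdaPrime d n := div_mul_cancel₀ _ hg.ne'
  have hp0 : 0 ≤ p := by positivity
  have hexp : (1 - p) ^ (k / 2) ≤ Real.exp (-(4 * (d + 2)) * Real.log n) := by
    calc (1 - p) ^ (k / 2) ≤ Real.exp (-p) ^ (k / 2) :=
          pow_le_pow_left₀ (by linarith) (Real.one_sub_le_exp_neg p) _
      _ = Real.exp (((k / 2 : ℕ) : ℝ) * -p) := (Real.exp_nat_mul _ _).symm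
      _ ≤ _ := by
          refine Real.exp_le_exp.2 ?_
          have h1 : p * (g / 3) ≤ p * ((k / 2 : ℕ) : ℝ) :=
            mul_le_mul_of_nonneg_left (by linarith) hp0
          have h2 : lambdaPrime d n = 12 * (d + 2) * Real.log n := rfl
          linarith
  calc (n : ℝ) * (1 - p) ^ (k / 2)
      ≤ Real.exp (Real.log n) * Real.exp (-(4 * (d + 2)) * Real.log n) := by
        rw [Real.exp_log hn0]
        gcongr
    _ = Real.exp (Real.log n + -(4 * (d + 2)) * Real.log n) := (Real.exp_add _ _).symm
    _ ≤ Real.exp (Real.log n * -d) := by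
        refine Real.exp_le_exp.2 ?_
        nlinarith [mul_nonneg hd (by linarith : 0 ≤ Real.log n)]
    _ = (n : ℝ) ^ (-d) := (Real.rpow_def_of_pos hn0 _).symm

theorem ceil_logb_le {n : ℕ} (hn : 2 ≤ n) :
    (⌈Real.logb (3 / 2) n⌉₊ : ℝ) ≤ (1 / Real.log (3 / 2) + 1 / Real.log 2) * Real.log n := by
  have hn2 : (2 : ℝ) ≤ n := by exact_mod_cast hn
  have hlog : Real.log 2 ≤ Real.log n := Real.log_le_log (by norm_num) hn2
  have h2 : 0 < Real.log 2 := Real.log_pos (by norm_num)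
  have h32 : 0 < Real.log (3 / 2) := Real.log_pos (by norm_num)
  have hceil := Nat.ceil_lt_add_one (Real.logb_nonneg (b := 3 / 2) (x := n) (by norm_num)
    (by linarith))
  -- The extra 1 from the ceiling is absorbed into the logarithm, as `n ≥ 2`.
  have h1 : 1 ≤ 1 / Real.log 2 * Real.log n := by
    rw [one_div_mul_eq_div, one_le_div h2]
    exact hlog
  have h3 : Real.logb (3 / 2) n = 1 / Real.log (3 / 2) * Real.log n := by
    rw [Real.logb, one_div_mul_eq_div]
  rw [add_mul]
  linarith

end StrongConn

theorem mainTheorem2 :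
    ∃ C : ℝ, 0 < C ∧
      ∀ (d : ℝ), 0 ≤ d →
      ∀ (V : Type*) [Fintype V] (G : SimpleGraph V) (u v : V), G.Adj u v →
      ∀ (g : ℝ), 0 < g → g ≤ (StrongConn.strongConnectivity G s(u, v) : ℝ) →
        (StrongConn.tester G u v d g).toOuterMeasure
            {o | ¬ (o.1 = true ∧ ∀ S ∈ o.2, v ∈ S)} ≤
          ENNReal.ofReal
            (C * (Fintype.card V : ℝ) ^ (-d) * Real.log (Fintype.card V)) := by
  have h2 : 0 < Real.log 2 := Real.log_pos (by norm_num)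
  have h32 : 0 < Real.log (3 / 2) := Real.log_pos (by norm_num)
  refine ⟨1 / Real.log (3 / 2) + 1 / Real.log 2, by positivity, ?_⟩
  intro d hd V _ G u v huv g hg hgs
  have hne : u ≠ v := G.ne_of_adj huv
  have hn : 2 ≤ Fintype.card V := Fintype.one_lt_card_iff.2 ⟨u, v, hne⟩
  have hs : 0 < StrongConn.strongConnectivity G s(u, v) := by exact_mod_cast hg.trans_le hgs
  obtain ⟨W, hu, hv, hW⟩ := StrongConn.exists_isKConnected_strongConnectivity G hne hs
  set n := Fintype.card V with hn_def
  set p := StrongConn.lambdaPrime d n / g with hp_def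
  have hlog : 0 ≤ Real.log n := Real.log_natCast_nonneg n
  have hp0 : 0 ≤ p := by
    rw [hp_def, StrongConn.lambdaPrime]
    positivity
  have hδ : ∀ S, W ⊆ S → (StrongConn.skeleton G S p).toOuterMeasure
      {F | ¬ W ⊆ StrongConn.reachableSet F u} ≤ ENNReal.ofReal ((n : ℝ) ^ (-d)) := by
    intro S hS
    rcases le_or_gt 1 p with hp | hp
    · rw [StrongConn.skeleton_disconnect_eq_zero hS hs hW hu hp]
      exact zero_le
    · exact (StrongConn.skeleton_disconnect_le hS hW hu hv hne hp0 hp.le).trans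
        (ENNReal.ofReal_le_ofReal (StrongConn.one_sub_pow_half_le hn hd hg hgs hp))
  refine (StrongConn.testerRounds_failure_le G hv hδ _ Set.univ (Set.subset_univ W)).trans ?_
  rw [← ENNReal.ofReal_natCast, ← ENNReal.ofReal_mul (Nat.cast_nonneg _)]
  refine ENNReal.ofReal_le_ofReal ?_
  rw [mul_right_comm]
  exact mul_le_mul_of_nonneg_right (StrongConn.ceil_logb_le hn) (by positivity)
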